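/- Let $H$ be a finitely generated virtually nilpotent group, i.e. a finitely generated group with a nilpotent subgroup of finite index. Let $X$ be a finite set, let $\sigma : X^* \to H$ be a surjective monoid morphism from the free monoid on $X$, and let $n \in \mathbb{N}$ (with $0 \in \mathbb{N}$). Suppose that the word problem $\{w \in X^* : w\sigma = 1\}$ of $H$ with respect to $\sigma$ is the language accepted by some $\mathbb{Z}^n$-automaton over $X$. Then $H$ is virtually abelian, i.e. it has an abelian subgroup of finite index. Here a $\mathbb{Z}^n$-automaton over $X$ is a (nondeterministic) finite automaton over the direct product monoid $\mathbb{Z}^n \times X^*$: it has finitely many states, a start state, a set of terminal states, and finitely many directed edges, each labelled by an element of $\mathbb{Z}^n \times X^*$. The label of a path is the product of the labels of its edges (the empty path has the identity as label), and the automaton accepts the word $w \in X^*$ if some path from the start state to a terminal state has label $(0, w)$, where $0$ is the identity of $\mathbb{Z}^n$. -/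

import Mathlib

universe u v w

/-- A finite automaton over the monoid `M` with state set `Q`: finitely many states, a start
state, a set of terminal states, and a finite set of edges labelled by elements of `M`. -/
structure FiniteAutomaton (M : Type u) (Q : Type v) where
  finite_states : Finite Q
  start : Q
  terminal : Set Q
  /-- `(p, m, q)` is an edge from `p` to `q` with label `m`. -/
  edges : Set (Q × M × Q)
  finite_edges : edges.Finite

namespace FiniteAutomaton

/-- `A.Path p m q`: some path (possibly empty) of `A` from `p` to `q` has label `m`, the product
in `M`, in order, of the labels of its edges. -/
inductive Path {M : Type u} [Monoid M] {Q : Type v} (A : FiniteAutomaton M Q) : Q → M → Q → Prop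
  | nil (q : Q) : Path A q 1 q
  | cons {p q r : Q} {m m' : M} (e : (p, m, q) ∈ A.edges) (h : Path A q m' r) :
      Path A p (m * m') r

/-- `A` accepts `m` if `m` labels a path from the start state to a terminal state. -/
def Accepts {M : Type u} [Monoid M] {Q : Type v} (A : FiniteAutomaton M Q) (m : M) : Prop :=
  ∃ t ∈ A.terminal, A.Path A.start m t

end FiniteAutomaton

/-- An `M`-automaton over the alphabet `X`: a finite automaton over `M × X*`. -/
abbrev RegisterAutomaton (M : Type u) (X : Type w) (Q : Type v) :=
  FiniteAutomaton (M × FreeMonoid X) Q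

/-- The language accepted by an `M`-automaton over `X`: all words `w` such that `(1, w)` labels a
path from the start state to a terminal state. -/
def RegisterAutomaton.language {M : Type u} [Monoid M] {X : Type w} {Q : Type v}
    (A : RegisterAutomaton M X Q) : Set (FreeMonoid X) :=
  {w | FiniteAutomaton.Accepts A ((1, w) : M × FreeMonoid X)}

/-- The free abelian group `ℤⁿ`, written multiplicatively so that it can serve as a register. -/
abbrev IntPow (n : ℕ) : Type := Multiplicative (Fin n → ℤ)

/-- The word problem of `H` with respect to `σ : X* → H`: the words representing `1`. -/
def wordProblem {X : Type w} {H : Type u} [Group H] (σ : FreeMonoid X →* H) :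
    Set (FreeMonoid X) :=
  {w | σ w = 1}

/-- `H` has an abelian subgroup of finite index. -/
def IsVirtuallyAbelian (H : Type u) [Group H] : Prop :=
  ∃ K : Subgroup H, IsMulCommutative K ∧ K.FiniteIndex

/-! The register is commutative, so if an accepting run passes three times through one
configuration, its two loops can be swapped and the loops represent commuting elements of `H`. Along
a run reading a power of `a ^ k * b`, two pigeonholes over finitely many configurations give such
loops, so `a ^ r` commutes with `(a ^ k * b) ^ d`, with `r`, `d` bounded independently of `a`, `b`
(`exists_commute_pow`). When `⁅a, b⁆` commutes with `a` and `b`, this forces `⁅a, b⁆ ^ (r * d) = 1`;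
hence one exponent kills all such commutators. In a finitely generated nilpotent group this makes
the quotient by the centre torsion, hence finite. Applied to a nilpotent subgroup of finite index,
whose centre is then abelian of finite index in `H`, this proves the theorem. -/

open scoped commutatorElement

/-! ### Commutators of bounded order in nilpotent groups -/

section GroupTheory

variable {G : Type*} [Group G]

/-- If `⁅x, y⁆` commutes with `x`, then `⁅x ^ m, y⁆ = ⁅x, y⁆ ^ m`. -/
theorem commutatorElement_pow_left {x y : G} (h : Commute ⁅x, y⁆ x) (m : ℕ) :
    ⁅x ^ m, y⁆ = ⁅x, y⁆ ^ m := by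
  induction m with
  | zero => simp
  | succ m ih =>
    have h1 : ⁅x ^ (m + 1), y⁆ = x * ⁅x ^ m, y⁆ * x⁻¹ * ⁅x, y⁆ := by
      simp only [commutatorElement_def, pow_succ']
      group
    rw [h1, ih, (h.symm.pow_right m).eq, pow_succ]
    group

/-- If `⁅a, b⁆` commutes with `a` and `b`, then it is killed by `r * d` as soon as `a ^ r`
commutes with `(a ^ k * b) ^ d`. -/
theorem commutatorElement_pow_eq_one_of_commute {a b : G} (ha : Commute ⁅a, b⁆ a)
    (hb : Commute ⁅a, b⁆ b) {r k d : ℕ} (h : Commute (a ^ r) ((a ^ k * b) ^ d)) :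
    ⁅a, b⁆ ^ (r * d) = 1 := by
  have hC : ⁅a ^ r, b⁆ = ⁅a, b⁆ ^ r := commutatorElement_pow_left ha r
  have hCa : Commute (⁅a, b⁆ ^ r) a := ha.pow_left r
  have hCg : Commute (⁅a, b⁆ ^ r) (a ^ k * b) := (hCa.pow_right k).mul_right (hb.pow_left r)
  have hAb : a ^ r * b = ⁅a, b⁆ ^ r * (b * a ^ r) := by
    rw [← hC, commutatorElement_def]; group
  have hAg : a ^ r * (a ^ k * b) = ⁅a, b⁆ ^ r * ((a ^ k * b) * a ^ r) := by
    calc a ^ r * (a ^ k * b) = a ^ k * (a ^ r * b) := by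
          rw [← mul_assoc, ← pow_add, add_comm, pow_add, mul_assoc]
      _ = ⁅a, b⁆ ^ r * ((a ^ k * b) * a ^ r) := by
          rw [hAb, ← mul_assoc, ← (hCa.pow_right k).eq]
          simp only [mul_assoc]
  -- Moving `a ^ r` past each factor `a ^ k * b` costs one `⁅a, b⁆ ^ r`, which commutes with that
  -- factor.
  have key : ∀ e : ℕ, a ^ r * (a ^ k * b) ^ e
      = (⁅a, b⁆ ^ r) ^ e * ((a ^ k * b) ^ e * a ^ r) := by
    intro e
    induction e with
    | zero => simp
    | succ e ih =>
      calc a ^ r * (a ^ k * b) ^ (e + 1)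
          = (⁅a, b⁆ ^ r) ^ e * ((a ^ k * b) ^ e * (a ^ r * (a ^ k * b))) := by
            rw [pow_succ, ← mul_assoc, ih]; simp only [mul_assoc]
        _ = (⁅a, b⁆ ^ r) ^ e * (((a ^ k * b) ^ e * ⁅a, b⁆ ^ r) * ((a ^ k * b) * a ^ r)) := by
            rw [hAg]; simp only [mul_assoc]
        _ = _ := by
            rw [← (hCg.pow_right e).eq, pow_succ (⁅a, b⁆ ^ r), pow_succ (a ^ k * b)]
            simp only [mul_assoc]
  have h2 := key d
  rw [h.eq] at h2
  rw [pow_mul]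
  exact (mul_eq_right.mp h2.symm)

/-- A finitely generated solvable torsion group is finite. -/
theorem finite_of_fg_isSolvable_isMulTorsion [Group.FG G] [Group.IsSolvable G]
    (hG : IsMulTorsion G) : Finite G := by
  -- A term of finite index is finitely generated, so its abelianization is finitely generated and
  -- torsion, hence finite.
  have key : ∀ k, (derivedSeries G k).FiniteIndex := by
    intro k
    induction k with
    | zero => rw [derivedSeries_zero]; infer_instance
    | succ k ih =>
      have : Group.FG (derivedSeries G k) := Subgroup.fg_of_index_ne_zero _
      have : Group.FG (Abelianization (derivedSeries G k)) := QuotientGroup.fg _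
      have hfin : Finite (Abelianization (derivedSeries G k)) := by
        refine CommGroup.finite_of_fg_isMulTorsion _ fun x => ?_
        obtain ⟨⟨y, hy⟩, rfl⟩ := QuotientGroup.mk_surjective x
        have : IsOfFinOrder (⟨y, hy⟩ : derivedSeries G k) := by
          exact Submonoid.isOfFinOrder_coe.mp (hG y)
        exact (QuotientGroup.mk' (commutator (derivedSeries G k))).isOfFinOrder this
      have hidx : (commutator (derivedSeries G k)).FiniteIndex :=
        @Subgroup.finiteIndex_of_finite_quotient _ _ _ hfin
      constructor
      rw [derivedSeries_succ, ← Subgroup.map_subtype_commutator, Subgroup.index_map_subtype]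
      exact mul_ne_zero hidx.index_ne_zero ih.index_ne_zero
  obtain ⟨k, hk⟩ := (Group.isSolvable_def G).mp inferInstance
  have := key k
  rw [hk] at this
  exact Nat.finite_of_card_ne_zero (Subgroup.index_bot (G := G) ▸ this.index_ne_zero)

/-- If a positive power `m` kills every commutator `⁅a, b⁆` commuting with `a` and `b`, then it maps
each term of the upper central series above the centre into the preceding one. -/
theorem pow_mem_upperCentralSeries {m : ℕ}
    (h : ∀ a b : G, Commute ⁅a, b⁆ a → Commute ⁅a, b⁆ b → ⁅a, b⁆ ^ m = 1) (i : ℕ) :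
    ∀ x ∈ Subgroup.upperCentralSeries G (i + 2), x ^ m ∈ Subgroup.upperCentralSeries G (i + 1) := by
  induction i with
  | zero =>
    intro x hx
    rw [Subgroup.mem_upperCentralSeries_succ_iff] at hx ⊢
    intro y
    have hc := hx y
    rw [Subgroup.upperCentralSeries_one, Subgroup.mem_center_iff] at hc
    rw [commutatorElement_pow_left (hc x).symm, h x y (hc x).symm (hc y).symm]
    exact one_mem _
  | succ i ih =>
    intro x hx
    rw [Subgroup.mem_upperCentralSeries_succ_iff] at hx ⊢
    intro y
    have hc := hx y
    have hcx := Subgroup.mem_upperCentralSeries_succ_iff.mp hc x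
    -- Modulo this term, `⁅x, y⁆` commutes with `x`, so `⁅x ^ m, y⁆` becomes `⁅x, y⁆ ^ m`, which
    -- `ih` makes trivial.
    let π := QuotientGroup.mk' (Subgroup.upperCentralSeries G (i + 1))
    have hcomm : Commute ⁅π x, π y⁆ (π x) := by
      rw [← commutatorElement_eq_one_iff_commute, ← map_commutatorElement,
        ← map_commutatorElement]
      exact (QuotientGroup.eq_one_iff _).mpr hcx
    have hpow := commutatorElement_pow_left hcomm m
    rw [← map_pow, ← map_commutatorElement, ← map_commutatorElement, ← map_pow] at hpow
    have h1 : π (⁅x, y⁆ ^ m) = 1 := (QuotientGroup.eq_one_iff _).mpr (ih _ hc)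
    rw [h1] at hpow
    exact (QuotientGroup.eq_one_iff _).mp hpow

/-- In a finitely generated nilpotent group where a fixed positive power kills every commutator
`⁅a, b⁆` commuting with `a` and `b`, the centre has finite index. -/
theorem finiteIndex_center_of_commutatorElement_pow_eq_one [Group.FG G] [Group.IsNilpotent G]
    {m : ℕ} (hm : 0 < m)
    (h : ∀ a b : G, Commute ⁅a, b⁆ a → Commute ⁅a, b⁆ b → ⁅a, b⁆ ^ m = 1) :
    (Subgroup.center G).FiniteIndex := by
  have hpow : ∀ (i : ℕ) (x : G), x ∈ Subgroup.upperCentralSeries G (i + 1) →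
      x ^ m ^ i ∈ Subgroup.center G := by
    intro i
    induction i with
    | zero => intro x hx; simpa using hx
    | succ i ih =>
      intro x hx
      rw [pow_succ', pow_mul]
      exact ih _ (pow_mem_upperCentralSeries h i x hx)
  obtain ⟨k, hk⟩ := Group.IsNilpotent.nilpotent G
  have htop : ∀ x : G, x ∈ Subgroup.upperCentralSeries G (k + 1) := fun x =>
    Subgroup.upperCentralSeries_mono G k.le_succ (hk ▸ Subgroup.mem_top x)
  have htors : IsMulTorsion (G ⧸ Subgroup.center G) := by
    intro x
    obtain ⟨y, rfl⟩ := QuotientGroup.mk_surjective x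
    rw [isOfFinOrder_iff_pow_eq_one]
    refine ⟨m ^ k, pow_pos hm k, ?_⟩
    rw [← QuotientGroup.mk_pow]
    exact (QuotientGroup.eq_one_iff _).mpr (hpow k y (htop y))
  have := finite_of_fg_isSolvable_isMulTorsion htors
  exact Subgroup.finiteIndex_of_finite_quotient

end GroupTheory

theorem exists_lt_map_eq_of_card_le {α : Type*} [Finite α] {n : ℕ} (f : Fin (n + 1) → α)
    (h : Nat.card α ≤ n) : ∃ i j, i < j ∧ f i = f j := by
  have := Fintype.ofFinite α
  rw [Nat.card_eq_fintype_card] at h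
  obtain ⟨i, j, hne, hij⟩ :=
    Fintype.exists_ne_map_eq_of_card_lt f (by rw [Fintype.card_fin]; omega)
  rcases lt_or_gt_of_ne hne with hlt | hlt
  · exact ⟨i, j, hlt, hij⟩
  · exact ⟨j, i, hlt, hij.symm⟩

/-! ### Cutting runs at prefixes of the input -/

namespace RegisterAutomaton

variable {M : Type*} {X : Type*} {Q : Type*}

/-- A configuration: a state together with letters consumed from the input ahead of the edges
that read them. -/
abbrev Config (X Q : Type*) := Q × FreeMonoid X

/-- From configuration `c`, the automaton can read `w` and reach `c'`, changing the register by
`z`. -/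
def Run [Monoid M] (A : RegisterAutomaton M X Q) (c : Config X Q) (z : M) (w : FreeMonoid X)
    (c' : Config X Q) : Prop :=
  -- The path reads the old pending letters and then `w`, except for the letters left pending in
  -- `c'`.
  ∃ y, A.Path c.1 (z, y) c'.1 ∧ c.2 * w = y * c'.2

/-- The pending words that can arise when a path is cut inside an edge. -/
def pending [Monoid M] (A : RegisterAutomaton M X Q) : Set (FreeMonoid X) :=
  {1} ∪ ⋃ e ∈ A.edges, {s | ∃ t, e.2.1.2 = s * t}

theorem finite_pending [Monoid M] (A : RegisterAutomaton M X Q) : A.pending.Finite := by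
  refine (Set.finite_singleton _).union (A.finite_edges.biUnion fun e _ => ?_)
  refine (List.finite_toSet (e.2.1.2.toList.inits)).subset ?_
  rintro s ⟨t, ht⟩
  exact (List.mem_inits _ _).mpr ⟨t, ht.symm⟩

variable [CommGroup M] {A : RegisterAutomaton M X Q}

theorem _root_.FiniteAutomaton.Path.trans {N : Type*} [Monoid N] {B : FiniteAutomaton N Q}
    {p q r : Q} {m m' : N} (h : B.Path p m q) (h' : B.Path q m' r) : B.Path p (m * m') r := by
  induction h with
  | nil => simpa using h'
  | cons e _ ih => rw [mul_assoc]; exact .cons e (ih h')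

theorem Run.refl (c : Config X Q) : A.Run c 1 1 c := ⟨1, .nil _, by simp⟩

theorem Run.trans {c c' c'' : Config X Q} {z z' : M} {w w' : FreeMonoid X}
    (h : A.Run c z w c') (h' : A.Run c' z' w' c'') : A.Run c (z * z') (w * w') c'' := by
  obtain ⟨y, hp, hy⟩ := h
  obtain ⟨y', hp', hy'⟩ := h'
  refine ⟨y * y', hp.trans hp', ?_⟩
  rw [← mul_assoc, hy, mul_assoc, hy', mul_assoc]

/-- A path reading `v₁ * v₂` can be cut at `v₁`, up to a pending word. -/
theorem exists_path_cut {p t : Q} {m : M × FreeMonoid X} (h : A.Path p m t) :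
    ∀ v₁ v₂ : FreeMonoid X, m.2 = v₁ * v₂ →
      ∃ (q : Q) (s y₁ y₂ : FreeMonoid X) (z₁ z₂ : M), s ∈ A.pending ∧ m.1 = z₁ * z₂ ∧
        A.Path p (z₁, y₁) q ∧ A.Path q (z₂, y₂) t ∧ v₁ = y₁ * s ∧ y₂ = s * v₂ := by
  induction h with
  | nil q =>
    intro v₁ v₂ hv
    have hv' : v₁.toList ++ v₂.toList = [] := hv.symm
    obtain ⟨h1, h2⟩ := List.append_eq_nil_iff.mp hv'
    obtain rfl : v₁ = 1 := h1
    obtain rfl : v₂ = 1 := h2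
    exact ⟨q, 1, 1, 1, 1, 1, .inl rfl, by simp, .nil _, .nil _, by simp, by simp⟩
  | @cons p q r m m' e h ih =>
    intro v₁ v₂ hv
    have hv' : m.2.toList ++ m'.2.toList = v₁.toList ++ v₂.toList := hv
    rcases List.append_eq_append_iff.mp hv' with ⟨a, ha, hb⟩ | ⟨a, ha, hb⟩
    · obtain ⟨q', s, y₁, y₂, z₁, z₂, hs, hz, h1, h2, e1, e2⟩ := ih (FreeMonoid.ofList a) v₂ hb
      have ha' : v₁ = m.2 * FreeMonoid.ofList a := ha
      refine ⟨q', s, m.2 * y₁, y₂, m.1 * z₁, z₂, hs, ?_, .cons e h1, h2, ?_, e2⟩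
      · rw [Prod.fst_mul, hz, mul_assoc]
      · rw [ha', e1, mul_assoc]
    -- The cut falls within the first edge: stop before it and keep `v₁`, a prefix of its label,
    -- pending.
    · have ha' : m.2 = v₁ * FreeMonoid.ofList a := ha
      refine ⟨p, v₁, 1, (m * m').2, 1, (m * m').1, .inr ?_, by simp, .nil _, .cons e h, by simp,
        hv⟩
      simp only [Set.mem_iUnion]
      exact ⟨_, e, _, ha'⟩

/-- A run to a configuration without pending letters can be cut after any prefix of its input. -/
theorem Run.exists_cut {c : Config X Q} {t : Q} {z : M} {w₁ w₂ : FreeMonoid X}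
    (h : A.Run c z (w₁ * w₂) (t, 1)) :
    ∃ c' z', c'.2 ∈ A.pending ∧ A.Run c z' w₁ c' ∧ A.Run c' (z'⁻¹ * z) w₂ (t, 1) := by
  obtain ⟨y, hp, hy⟩ := h
  obtain ⟨q, s, y₁, y₂, z₁, z₂, hs, hz, h1, h2, e1, e2⟩ :=
    exists_path_cut hp (c.2 * w₁) w₂ (by rw [mul_assoc, hy]; simp)
  have hz' : z = z₁ * z₂ := hz
  refine ⟨(q, s), z₁, hs, ⟨y₁, h1, e1⟩, y₂, ?_, by simp [e2]⟩
  rw [hz', inv_mul_cancel_left]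
  exact h2

/-- The configurations and registers along a run, recorded after each factor of its input. -/
theorem Run.exists_sequence (f : ℕ → FreeMonoid X) (w' : FreeMonoid X) {t : Q} (m : ℕ) :
    ∀ {c : Config X Q} {z : M}, c.2 ∈ A.pending →
      A.Run c z (((List.range m).map f).prod * w') (t, 1) →
      ∃ (γ : ℕ → Config X Q) (ζ : ℕ → M), γ 0 = c ∧ ζ 0 = 1 ∧ (∀ i ≤ m, (γ i).2 ∈ A.pending) ∧
        (∀ i < m, A.Run (γ i) ((ζ i)⁻¹ * ζ (i + 1)) (f i) (γ (i + 1))) ∧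
        A.Run (γ m) ((ζ m)⁻¹ * z) w' (t, 1) := by
  induction m generalizing w' with
  | zero =>
    intro c z hc h
    exact ⟨fun _ => c, fun _ => 1, rfl, rfl, fun _ _ => hc, by simp, by simpa using h⟩
  | succ m ih =>
    intro c z hc h
    rw [List.range_succ, List.map_append, List.prod_append, mul_assoc] at h
    obtain ⟨γ, ζ, h0, hζ, hpend, hrun, hlast⟩ := ih _ hc h
    obtain ⟨c', z', hc', h1, h2⟩ := hlast.exists_cut
    refine ⟨Function.update γ (m + 1) c', Function.update ζ (m + 1) (ζ m * z'), ?_, ?_, ?_, ?_, ?_⟩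
    · simpa using h0
    · simpa using hζ
    · intro i hi
      rcases hi.eq_or_lt with rfl | hi
      · simpa using hc'
      · rw [Function.update_of_ne hi.ne]
        exact hpend i (Nat.lt_succ_iff.mp hi)
    · intro i hi
      rw [Function.update_of_ne hi.ne, Function.update_of_ne hi.ne]
      rcases (Nat.lt_succ_iff.mp hi).eq_or_lt with rfl | hi'
      · simpa using h1
      · rw [Function.update_of_ne (by omega), Function.update_of_ne (by omega)]
        exact hrun i hi'
    · simpa [mul_assoc] using h2

/-! ### From repeated configurations to commutators of bounded order -/

section WordProblem

variable {H : Type*} [Group H] {σ : FreeMonoid X →* H}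

/-- Consecutive loops at a configuration on an accepting run can be interchanged, so they
represent commuting elements. -/
theorem commute_of_loops (hA : A.language = wordProblem σ) {c : Config X Q} {t : Q}
    (ht : t ∈ A.terminal) {z₁ z₂ z₃ z₄ : M} {x y y' x' : FreeMonoid X}
    (h₁ : A.Run (A.start, 1) z₁ x c) (h₂ : A.Run c z₂ y c) (h₃ : A.Run c z₃ y' c)
    (h₄ : A.Run c z₄ x' (t, 1)) (hz : z₁ * z₂ * z₃ * z₄ = 1) : Commute (σ y) (σ y') := by
  have acc : ∀ {w}, A.Run (A.start, 1) 1 w (t, 1) → σ w = 1 := by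
    rintro w ⟨v, hp, hv⟩
    obtain rfl : w = v := by simpa using hv
    have : w ∈ A.language := ⟨t, ht, hp⟩
    rwa [hA] at this
  have e₁ := acc (hz ▸ ((h₁.trans h₂).trans h₃).trans h₄)
  -- Commutativity of the register makes the swapped run accepting as well.
  have hz' : z₁ * z₃ * z₂ * z₄ = 1 := by rw [mul_right_comm z₁, hz]
  have e₂ := acc (hz' ▸ ((h₁.trans h₃).trans h₂).trans h₄)
  have := e₁.trans e₂.symm
  rw [map_mul, map_mul, map_mul, map_mul, map_mul, map_mul, mul_left_inj, mul_assoc, mul_assoc,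
    mul_right_inj] at this
  exact this

/-- For a sequence of group elements, one can choose configurations in a finite set such that
returns to a configuration yield commuting elements. -/
theorem exists_config_sequence (hσ : Function.Surjective σ) (hA : A.language = wordProblem σ)
    (g : ℕ → H) (m : ℕ) :
    ∃ γ : ℕ → Config X Q, (∀ i ≤ m, (γ i).2 ∈ A.pending) ∧
      ∀ i j k, i ≤ j → j ≤ k → k ≤ m → γ i = γ j → γ j = γ k →
        Commute ((g i)⁻¹ * g j) ((g j)⁻¹ * g k) := by
  choose f hf using fun i => hσ ((g i)⁻¹ * g (i + 1))
  -- `w'` completes the word to one representing `1`, so that an accepting run exists.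
  obtain ⟨w', hw'⟩ := hσ (σ ((List.range m).map f).prod)⁻¹
  have hmem : ((List.range m).map f).prod * w' ∈ A.language := by
    rw [hA]
    change σ _ = 1
    rw [map_mul, hw', mul_inv_cancel]
  obtain ⟨t, ht, hp⟩ := hmem
  have hrun : A.Run (A.start, 1) 1 (((List.range m).map f).prod * w') (t, 1) :=
    ⟨_, hp, by simp⟩
  obtain ⟨γ, ζ, h0, hζ, hpend, hstep, hlast⟩ := hrun.exists_sequence f w' m (.inl (Set.mem_singleton _))
  have seg : ∀ i j, i ≤ j → j ≤ m →
      ∃ y, σ y = (g i)⁻¹ * g j ∧ A.Run (γ i) ((ζ i)⁻¹ * ζ j) y (γ j) := by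
    intro i j hij
    induction j, hij using Nat.le_induction with
    | base => intro _; exact ⟨1, by simp, by simpa using Run.refl (A := A) (γ i)⟩
    | succ j hij ih =>
      intro hj
      obtain ⟨y, hy, hr⟩ := ih (by omega)
      refine ⟨y * f j, by rw [map_mul, hy, hf]; group, ?_⟩
      have := hr.trans (hstep j hj)
      rwa [mul_assoc, mul_inv_cancel_left] at this
  refine ⟨γ, hpend, fun i j k hij hjk hkm eij ejk => ?_⟩
  obtain ⟨x, -, hx⟩ := seg 0 i (Nat.zero_le _) (by omega)
  obtain ⟨y, hy, hyr⟩ := seg i j hij (by omega)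
  obtain ⟨y', hy', hyr'⟩ := seg j k hjk hkm
  obtain ⟨x', -, hx'⟩ := seg k m hkm le_rfl
  rw [← hy, ← hy']
  rw [h0] at hx
  rw [← ejk, ← eij] at hyr' hx'
  rw [← eij] at hyr
  refine commute_of_loops hA ht hx hyr hyr' (hx'.trans hlast) ?_
  rw [hζ]
  group

/-- There are uniform bounds such that a power of `a` commutes with a power of `a ^ k * b`. -/
theorem exists_commute_pow (hσ : Function.Surjective σ) (hA : A.language = wordProblem σ) :
    ∃ k n : ℕ, ∀ a b : H, ∃ r d : ℕ, 0 < r ∧ r ≤ k ∧ 0 < d ∧ d ≤ n ∧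
      Commute (a ^ r) ((a ^ k * b) ^ d) := by
  have := A.finite_states
  have := A.finite_pending.to_subtype
  let F := Q × A.pending
  let k := Nat.card F
  let n := Nat.card (F × Fin (k + 1) × Fin (k + 1))
  refine ⟨k, n, fun a b => ?_⟩
  -- Each block of `k + 1` positions takes `k` steps `a`, then `b` leads to the next block. A block
  -- has more positions than there are configurations, so one repeats; among `n + 1` blocks, two
  -- share the repeated configuration and both offsets.
  let g : ℕ → H := fun l => (a ^ k * b) ^ (l / (k + 1)) * a ^ (l % (k + 1))
  have hgval : ∀ i j : ℕ, j ≤ k → g (i * (k + 1) + j) = (a ^ k * b) ^ i * a ^ j := by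
    intro i j hj
    have h1 : (i * (k + 1) + j) / (k + 1) = i := by
      rw [mul_comm, Nat.mul_add_div (by omega), Nat.div_eq_of_lt (by omega), add_zero]
    have h2 : (i * (k + 1) + j) % (k + 1) = j := by
      rw [mul_comm, Nat.mul_add_mod, Nat.mod_eq_of_lt (by omega)]
    simp only [g, h1, h2]
  obtain ⟨γ, hpend, hcomm⟩ := exists_config_sequence hσ hA g ((n + 1) * (k + 1))
  have hle : ∀ i j, i ≤ n → j ≤ k → i * (k + 1) + j ≤ (n + 1) * (k + 1) := by
    intro i j hi hj
    have := Nat.mul_le_mul_right (k + 1) hi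
    rw [add_one_mul]
    omega
  let conf : Fin (n + 1) → Fin (k + 1) → F := fun i j =>
    ((γ (i * (k + 1) + j)).1, ⟨(γ (i * (k + 1) + j)).2,
      hpend _ (hle i j (by omega) (by omega))⟩)
  have hconf : ∀ {i i' j j'}, conf i j = conf i' j' →
      γ (i * (k + 1) + j) = γ (i' * (k + 1) + j') := by
    intro i i' j j' h
    obtain ⟨h1, h2⟩ := Prod.ext_iff.mp h
    exact Prod.ext h1 (congrArg Subtype.val h2)
  have hin : ∀ i, ∃ j j' : Fin (k + 1), j < j' ∧ conf i j = conf i j' := fun i =>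
    exists_lt_map_eq_of_card_le (conf i) le_rfl
  choose J J' hJ hJJ using hin
  obtain ⟨i, i', hlt, hdata⟩ : ∃ i i' : Fin (n + 1), i < i' ∧
      (conf i (J i), J i, J' i) = (conf i' (J i'), J i', J' i') := 
    exists_lt_map_eq_of_card_le (fun i => (conf i (J i), J i, J' i)) le_rfl
  simp only [Prod.mk.injEq] at hdata
  obtain ⟨hc, hj, -⟩ := hdata
  have hJi := hJ i
  obtain ⟨r, hr⟩ := Nat.exists_eq_add_of_lt (Fin.lt_def.mp hJi)
  obtain ⟨d, hd⟩ := Nat.exists_eq_add_of_lt (Fin.lt_def.mp hlt)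
  have hi'n : (i' : ℕ) ≤ n := by omega
  have hJk : (J i : ℕ) ≤ k := by omega
  have hJk' : (J' i : ℕ) ≤ k := by omega
  refine ⟨r + 1, d + 1, by omega, by omega, by omega, by omega, ?_⟩
  have hord : (i : ℕ) * (k + 1) + J' i ≤ i' * (k + 1) + J i' := by
    have : ((i : ℕ) + 1) * (k + 1) ≤ i' * (k + 1) := Nat.mul_le_mul_right _ hlt
    rw [add_one_mul] at this
    omega
  have key := hcomm (i * (k + 1) + J i) (i * (k + 1) + J' i) (i' * (k + 1) + J i')
    (by omega) hord (hle _ _ hi'n (by omega)) (hconf (hJJ i)) (hconf ((hJJ i).symm.trans hc))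
  rw [← hj, hgval _ _ hJk, hgval _ _ hJk', hgval _ _ hJk] at key
  have e1 : ((a ^ k * b) ^ (i : ℕ) * a ^ (J i : ℕ))⁻¹ * ((a ^ k * b) ^ (i : ℕ) * a ^ (J' i : ℕ))
      = a ^ (r + 1) := by
    rw [hr, add_assoc, pow_add a (J i : ℕ)]
    group
  have e2 : ((a ^ k * b) ^ (i : ℕ) * a ^ (J' i : ℕ))⁻¹ * ((a ^ k * b) ^ (i' : ℕ) * a ^ (J i : ℕ))
      = (a ^ (J' i : ℕ))⁻¹ * (a ^ k * b) ^ (d + 1) * a ^ (J i : ℕ) := by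
    rw [hd, add_assoc, pow_add (a ^ k * b)]
    simp only [mul_inv_rev, mul_assoc, inv_mul_cancel_left]
  rw [e1, e2] at key
  -- The second loop is `(a ^ k * b) ^ (d + 1)` flanked by powers of `a`, which commute with `a ^ (r
  -- + 1)` and can be stripped.
  have hself : ∀ s : ℕ, Commute (a ^ (r + 1)) (a ^ s) := fun s => Commute.pow_pow_self a _ _
  have := ((hself (J' i)).mul_right key).mul_right (hself (J i)).inv_right
  simpa only [mul_assoc, mul_inv_cancel_left, mul_inv_cancel, mul_one] using this

/-- If a group has a word problem accepted by a blind counter automaton, then a fixed positive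
power kills every commutator `⁅a, b⁆` commuting with `a` and `b`. -/
theorem exists_commutatorElement_pow_eq_one (hσ : Function.Surjective σ)
    (hA : A.language = wordProblem σ) :
    ∃ m : ℕ, 0 < m ∧ ∀ a b : H, Commute ⁅a, b⁆ a → Commute ⁅a, b⁆ b → ⁅a, b⁆ ^ m = 1 := by
  obtain ⟨k, n, h⟩ := exists_commute_pow hσ hA
  -- `r * d` depends on `a` and `b`, but being positive and at most `k * n` it divides this
  -- factorial.
  refine ⟨(k * n).factorial, Nat.factorial_pos _, fun a b ha hb => ?_⟩
  obtain ⟨r, d, hr, hrk, hd, hdn, hcomm⟩ := h a b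
  have h1 := commutatorElement_pow_eq_one_of_commute ha hb hcomm
  obtain ⟨e, he⟩ := Nat.dvd_factorial (Nat.mul_pos hr hd) (Nat.mul_le_mul hrk hdn)
  rw [he, pow_mul, h1, one_pow]

end WordProblem

end RegisterAutomaton

theorem mainTheorem4 {H : Type*} [Group H] [Group.FG H]
    (hH : Group.IsVirtuallyNilpotent H)
    {X : Type*} [Finite X] (σ : FreeMonoid X →* H) (hσ : Function.Surjective σ)
    (n : ℕ) {Q : Type*} (A : RegisterAutomaton (IntPow n) X Q)
    (hA : A.language = wordProblem σ) :
    IsVirtuallyAbelian H := by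
  obtain ⟨K, hK, hKfin⟩ := hH
  obtain ⟨m, hm, h⟩ := RegisterAutomaton.exists_commutatorElement_pow_eq_one hσ hA
  have hKfg : Group.FG K := Subgroup.fg_of_index_ne_zero K
  have hcenter : (Subgroup.center K).FiniteIndex := by
    refine finiteIndex_center_of_commutatorElement_pow_eq_one hm fun a b ha hb => ?_
    -- The commutator condition passes from `H` to any subgroup.
    have := h (a : H) b (ha.map K.subtype) (hb.map K.subtype)
    exact Subtype.ext this
  refine ⟨(Subgroup.center K).map K.subtype, inferInstance, ⟨?_⟩⟩
  rw [Subgroup.index_map_subtype]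
  exact mul_ne_zero hcenter.index_ne_zero hKfin.index_ne_zero
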